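/- Let $0<\alpha<2$, let $d\ge 1$, let $\mathbb T=\mathbb Z$ or $\mathbb T=\mathbb R$, and equip $\mathbb T^d$ with $\lambda$, the counting measure if $\mathbb T=\mathbb Z$ and Lebesgue measure if $\mathbb T=\mathbb R$. Put $B(T)=(-T,T]^d\cap\mathbb T^d$, $C(T)=(2T)^d$ and $\|t\|=\max_i|t_i|$. A measurable set $D\subset\mathbb T^d$ has density one if $\lim_{T\to\infty}C(T)^{-1}\lambda(B(T)\setminus D)=0$. Let $X=\{X_t\}_{t\in\mathbb T^d}$ be a real random field on a probability space $(\Omega,\mathcal F,\mathbb P)$ that is measurable (i.e. $(t,\omega)\mapsto X_t(\omega)$ is jointly measurable), stationary (i.e. $\{X_{s+t}\}_{s}$ has the same finite-dimensional distributions as $\{X_s\}_{s}$ for every $t\in\mathbb T^d$), and symmetric $\alpha$-stable (S$\alpha$S), i.e. for every finite linear combination $Y=\sum_j c_jX_{t_j}$ with real coefficients there is $\sigma\ge 0$ with $\mathbb E e^{iuY}=e^{-\sigma^\alpha|u|^\alpha}$ for all $u\in\mathbb R$. For an event $B=\{X\in B'\}$ of $\sigma_X=\sigma(X_t:t\in\mathbb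 T^d)$, where $B'$ is in the product $\sigma$-algebra of $\mathbb R^{\mathbb T^d}$, write $\theta_t(B)=\{(X_{s-t})_{s\in\mathbb T^d}\in B'\}$ for its translate; up to null sets it does not depend on the choice of $B'$, and if $X_t=X_0\circ\theta_t$ for a measure-preserving action $\{\theta_t\}_{t\in\mathbb T^d}$ on $\Omega$, it is the image of $B$ under $\theta_t$. Then $X$ is ergodic, that is, $$\lim_{T\to\infty}\frac1{C(T)}\int_{B(T)}\mathbb P(A\cap\theta_t(B))\,\lambda(dt)=\mathbb P(A)\,\mathbb P(B)\quad\text{for all }A,B\in\sigma_X,$$ if and only if $X$ is weakly mixing, that is, there is a set $D\subset\mathbb T^d$ of density one such that $$\lim_{n\to\infty}\mathbb P(A\cap\theta_{t_n}(B))=\mathbb P(A)\,\mathbb P(B)$$ for all $A,B\in\sigma_X$ and all sequences $(t_n)_{n\in\mathbb N}$ in $D$ with $\|t_n\|\to\infty$. -/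

import Mathlib

open MeasureTheory Filter Topology

namespace StableField

/-- The parameter axis `𝕋` (only `ℤ` and `ℝ` are given this structure): its embedding into the real
line, and the reference measure on `𝕋^d`. -/
class Axis (𝕋 : Type) [MeasurableSpace 𝕋] where
  toReal : 𝕋 → ℝ
  refMeasure : (d : ℕ) → Measure (Fin d → 𝕋)

/-- On `ℤ^d` the reference measure is the counting measure. -/
noncomputable instance : Axis ℤ where
  toReal := fun k => (k : ℝ)
  refMeasure := fun _ => Measure.count

/-- On `ℝ^d` the reference measure is Lebesgue measure. -/
noncomputable instance : Axis ℝ where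
  toReal := fun x => x
  refMeasure := fun _ => volume

section Averages

variable {𝕋 : Type} [MeasurableSpace 𝕋] [Axis 𝕋]

/-- The box `(-T, T]^d ∩ 𝕋^d`. -/
def box (𝕋 : Type) [MeasurableSpace 𝕋] [Axis 𝕋] (d : ℕ) (T : ℝ) : Set (Fin d → 𝕋) :=
  {t | ∀ i, Axis.toReal (t i) ∈ Set.Ioc (-T) T}

/-- The average `(2T)^{-d} ∫_{(-T,T]^d ∩ 𝕋^d} h dλ`. -/
noncomputable def average {d : ℕ} (T : ℝ) (h : (Fin d → 𝕋) → ℝ) : ℝ :=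
  ((2 * T) ^ d)⁻¹ * ∫ t in box 𝕋 d T, h t ∂(Axis.refMeasure d)

/-- Density zero subsets of `𝕋^d`. -/
def HasDensityZero {d : ℕ} (E : Set (Fin d → 𝕋)) : Prop :=
  MeasurableSet E ∧ Tendsto (fun T : ℝ => average T (E.indicator fun _ => (1 : ℝ))) atTop (𝓝 0)

/-- Density one subsets of `𝕋^d`. -/
def HasDensityOne {d : ℕ} (D : Set (Fin d → 𝕋)) : Prop :=
  HasDensityZero Dᶜ

end Averages

section Fields

variable {𝕋 : Type} [NormedAddCommGroup 𝕋] [MeasurableSpace 𝕋] {d : ℕ}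
variable {Ω : Type*} [MeasurableSpace Ω]

/-- A probability law on `ℝ` is symmetric `α`-stable (degenerate case `σ = 0` included) if its
characteristic function is `u ↦ exp (-σ^α |u|^α)` for some scale `σ ≥ 0`. -/
def IsSaSLaw (α : ℝ) (ν : Measure ℝ) : Prop :=
  ∃ σ : ℝ, 0 ≤ σ ∧ ∀ u : ℝ, charFun ν u = (Real.exp (-(σ ^ α * |u| ^ α)) : ℂ)

/-- A field is symmetric `α`-stable if all finite linear combinations of its values are. -/
def IsSaSField (α : ℝ) (P : Measure Ω) (X : (Fin d → 𝕋) → Ω → ℝ) : Prop :=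
  ∀ (n : ℕ) (t : Fin n → Fin d → 𝕋) (c : Fin n → ℝ),
    IsSaSLaw α (P.map fun ω => ∑ j, c j * X (t j) ω)

/-- Joint measurability of `(t, ω) ↦ X_t(ω)`. -/
def IsMeasurableField (X : (Fin d → 𝕋) → Ω → ℝ) : Prop :=
  Measurable fun p : (Fin d → 𝕋) × Ω => X p.1 p.2

/-- Stationarity: every translate of the field has the same law on the path space `ℝ^(𝕋^d)` with its
product `σ`-algebra, that is, the same finite-dimensional distributions. -/
def IsStationary (P : Measure Ω) (X : (Fin d → 𝕋) → Ω → ℝ) : Prop :=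
  ∀ t : Fin d → 𝕋, P.map (fun ω s => X (s + t) ω) = P.map (fun ω s => X s ω)

/-- The event `{X ∈ B}` of `σ(X)`, for a set `B` of paths. -/
def pathEvent (X : (Fin d → 𝕋) → Ω → ℝ) (B : Set ((Fin d → 𝕋) → ℝ)) : Set Ω :=
  {ω | (fun s => X s ω) ∈ B}

/-- The translate `θ_t {X ∈ B} = {(X_{s - t})_s ∈ B}` of the event `{X ∈ B}`.
See `image_pathEvent`. -/
def translate (X : (Fin d → 𝕋) → Ω → ℝ) (t : Fin d → 𝕋) (B : Set ((Fin d → 𝕋) → ℝ)) : Set Ω :=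
  {ω | (fun s => X (s - t) ω) ∈ B}

/-- Ergodicity of a stationary field: for all events `{X ∈ A}` and `{X ∈ B}` of `σ(X)` the averages of
`t ↦ P({X ∈ A} ∩ θ_t {X ∈ B})` tend to the product of the probabilities. -/
def IsErgodic [Axis 𝕋] (P : Measure Ω) (X : (Fin d → 𝕋) → Ω → ℝ) : Prop :=
  ∀ A B : Set ((Fin d → 𝕋) → ℝ), MeasurableSet A → MeasurableSet B →
    Tendsto (fun T : ℝ => average T fun t => P.real (pathEvent X A ∩ translate X t B)) atTop
      (𝓝 (P.real (pathEvent X A) * P.real (pathEvent X B)))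

/-- Weak mixing of a stationary field: one density one set `D` serves all events of `σ(X)` and all
sequences in `D` that tend to infinity. -/
def IsWeaklyMixing [Axis 𝕋] (P : Measure Ω) (X : (Fin d → 𝕋) → Ω → ℝ) : Prop :=
  ∃ D : Set (Fin d → 𝕋), HasDensityOne D ∧
    ∀ A B : Set ((Fin d → 𝕋) → ℝ), MeasurableSet A → MeasurableSet B →
      ∀ t : ℕ → Fin d → 𝕋, (∀ n, t n ∈ D) → Tendsto (fun n => ‖t n‖) atTop atTop →
        Tendsto (fun n => P.real (pathEvent X A ∩ translate X (t n) B)) atTop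
          (𝓝 (P.real (pathEvent X A) * P.real (pathEvent X B)))

/-- The `σ`-algebra generated by a field consists of the events `{X ∈ B}`. -/
theorem measurableSet_iff_pathEvent (X : (Fin d → 𝕋) → Ω → ℝ) (E : Set Ω) :
    MeasurableSet[⨆ t, MeasurableSpace.comap (X t) inferInstance] E ↔
      ∃ B, MeasurableSet B ∧ pathEvent X B = E := by
  have h : (⨆ t, MeasurableSpace.comap (X t) inferInstance) =
      MeasurableSpace.comap (fun ω s => X s ω) MeasurableSpace.pi := by
    simp only [MeasurableSpace.pi, MeasurableSpace.comap_iSup, MeasurableSpace.comap_comp]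
    rfl
  rw [h]
  exact Iff.rfl

/-- If `X_t = X_0 ∘ θ_t` for an action `θ` of `𝕋^d`, the translate of an event is its image. -/
theorem image_pathEvent (θ : (Fin d → 𝕋) → Ω → Ω) (h0 : ∀ ω, θ 0 ω = ω)
    (hadd : ∀ u v ω, θ (v + u) ω = θ u (θ v ω)) (X : (Fin d → 𝕋) → Ω → ℝ)
    (hX : ∀ t ω, X t ω = X 0 (θ t ω)) (t : Fin d → 𝕋) (B : Set ((Fin d → 𝕋) → ℝ)) :
    θ t '' pathEvent X B = translate X t B := by
  have key : ∀ s u ω, X s (θ u ω) = X (s + u) ω := fun s u ω => by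
    rw [hX s, hX (s + u), add_comm s u, hadd s u]
  ext ω
  constructor
  · rintro ⟨ω', h, rfl⟩
    simpa [translate, pathEvent, key] using h
  · intro h
    refine ⟨θ (-t) ω, ?_, ?_⟩
    · simpa [translate, pathEvent, key, sub_eq_add_neg] using h
    · rw [← hadd t (-t) ω, neg_add_cancel, h0]

end Fields

end StableField

/-! Stability turns a rescaling into a square. If `W` is a finite linear combination of the
coordinates of the field, then `E exp(iW)` is a real number `r`, and `2^(1/α) W` has characteristic
value `r²`. Apply this to `W = Y ∘ θ_t - Z`, and let `φ t = E exp(i(Y ∘ θ_t - Z))`, `c = E exp(iZ)`,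
`d = E exp(iY)`. Ergodicity, tested on `exp(iY)` and `exp(iZ)`, says that the averages of `φ` tend
to `cd`. Tested on the exponentials of `2^(1/α) Y` and `2^(1/α) Z`, it says that the averages of
`φ²` tend to `(cd)²`. Hence the averages of `(φ - cd)²` tend to 0, and so do those of `|φ - cd|`
(`absMeanZero_of_isSaSLaw`).

Everything takes place in `L²` of the law of the field on path space. The correlations `⟨f, V_t g⟩`
of the centred Koopman operators `V_t` are sesquilinear and bounded uniformly in `t`. A property of
functions of `t` that is linear and closed under uniform limits therefore passes from a total set to
all `f`, `g` (`UniformlyClosed.inner_mem`). This is used with indicators, with exponentials, and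
finally with a countable dense set.

The dense set exists because joint measurability makes `L²` of the law separable
(`secondCountable_Lp_law`). Its countably many correlations are governed by one function with
vanishing averages (`exists_common_majorant`), and the Koopman–von Neumann argument
(`exists_full_density_set`) yields one density one set for all events.

The converse holds for measurable fields in general: the complement of the density one set and any
fixed ball carry a vanishing part of the average. -/

namespace StableField

/-! ### Extension of linear properties from total sets -/

section UniformLimits

variable {ι : Type*}

/-- A linear space of complex functions that is closed under uniform limits. -/
def UniformlyClosed (W : Submodule ℂ (ι → ℂ)) : Prop :=
  ∀ k : ι → ℂ, (∀ ε > 0, ∃ k' ∈ W, ∀ t, ‖k t - k' t‖ ≤ ε) → k ∈ W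

variable {H : Type*} [NormedAddCommGroup H] [InnerProductSpace ℂ H]

/-- A subset of a Hilbert space is total if only `0` is orthogonal to it. -/
def IsTotal (S : Set H) : Prop := ∀ f : H, (∀ g ∈ S, inner ℂ g f = 0) → f = 0

theorem _root_.Dense.isTotal {S : Set H} (hS : Dense S) : IsTotal S := by
  intro f hf
  have : Set.EqOn (fun g : H => inner ℂ g f) (fun _ => 0) S := fun g hg => hf g hg
  have h := Continuous.ext_on hS (by fun_prop) (by fun_prop) this
  exact inner_self_eq_zero.1 (congrFun h f)

variable [CompleteSpace H]

theorem IsTotal.dense_span {S : Set H} (hS : IsTotal S) :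
    Dense (Submodule.span ℂ S : Set H) := by
  rw [Submodule.dense_iff_topologicalClosure_eq_top, Submodule.topologicalClosure_eq_top_iff,
    Submodule.eq_bot_iff]
  intro f hf
  refine hS f fun g hg => ?_
  exact (Submodule.mem_orthogonal _ _).1 hf g (Submodule.subset_span hg)

/-- A bounded semilinear map into functions takes values in a uniformly closed space as soon as it
does so on a total set. -/
theorem UniformlyClosed.map_mem {W : Submodule ℂ (ι → ℂ)} (hW : UniformlyClosed W)
    {S : Set H} (hS : IsTotal S) (F : H → ι → ℂ) (hadd : ∀ f g, F (f + g) = F f + F g)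
    (hsmul : ∀ (c : ℂ) f, ∃ c' : ℂ, F (c • f) = c' • F f) {M : ℝ}
    (hM : ∀ f t, ‖F f t‖ ≤ M * ‖f‖) (h : ∀ f ∈ S, F f ∈ W) (f : H) : F f ∈ W := by
  have hspan : ∀ g ∈ Submodule.span ℂ S, F g ∈ W := by
    intro g hg
    induction hg using Submodule.span_induction with
    | mem x hx => exact h x hx
    | zero =>
      obtain ⟨c, hc⟩ := hsmul 0 0
      have h0 : F 0 = 0 := by
        have := hadd 0 0
        simpa using this
      rw [h0]; exact W.zero_mem
    | add x y _ _ hx hy => rw [hadd]; exact W.add_mem hx hy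
    | smul c x _ hx =>
      obtain ⟨c', hc⟩ := hsmul c x
      rw [hc]; exact W.smul_mem _ hx
  refine hW _ fun ε hε => ?_
  have hpos : 0 < |M| + 1 := by positivity
  obtain ⟨g, hg, hfg⟩ := Metric.dense_iff.1 hS.dense_span f (ε / (|M| + 1)) (by positivity)
  refine ⟨F g, hspan g hfg, fun t => ?_⟩
  have hsub : F f t - F g t = F (f - g) t := by
    have := congrFun (hadd (f - g) g) t
    rw [sub_add_cancel] at this
    rw [this]; simp
  rw [hsub]
  have hd : ‖f - g‖ ≤ ε / (|M| + 1) := by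
    rw [← dist_eq_norm, dist_comm]; exact (Metric.mem_ball.1 hg).le
  calc ‖F (f - g) t‖ ≤ M * ‖f - g‖ := hM _ _
    _ ≤ (|M| + 1) * (ε / (|M| + 1)) := by
        gcongr
        linarith [le_abs_self M]
    _ = ε := by field_simp

/-- Extend in one argument at a time. The correlation is conjugate linear in `f`, which is why
`map_mem` asks only for some scalar `c'`; the common bound on the operators makes the approximation
uniform in `t`. -/
theorem UniformlyClosed.inner_mem {W : Submodule ℂ (ι → ℂ)} (hW : UniformlyClosed W)
    {S : Set H} (hS : IsTotal S) (V : ι → H →L[ℂ] H) {C : ℝ} (hV : ∀ t, ‖V t‖ ≤ C)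
    (h : ∀ f ∈ S, ∀ g ∈ S, (fun t => inner ℂ f (V t g)) ∈ W) (f g : H) :
    (fun t => inner ℂ f (V t g)) ∈ W := by
  have hb : ∀ f g t, ‖inner ℂ f (V t g)‖ ≤ ‖f‖ * (C * ‖g‖) := fun f g t =>
    (norm_inner_le_norm _ _).trans (by
      gcongr
      exact (V t).le_of_opNorm_le (hV t) g)
  refine hW.map_mem hS (fun f t => inner ℂ f (V t g)) (fun f g => ?_) (fun c f => ?_)
    (M := C * ‖g‖) (fun f t => (hb f g t).trans (mul_comm _ _).le) (fun f hf => ?_) f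
  · ext t; simp
  · exact ⟨starRingEnd ℂ c, by ext t; simp [mul_comm]⟩
  · refine hW.map_mem hS (fun g t => inner ℂ f (V t g)) (fun f g => ?_) (fun c f => ?_)
      (M := ‖f‖ * C) (fun g t => (hb f g t).trans (mul_assoc _ _ _).ge) (fun g hg => h f hf g hg) g
    · ext t; simp
    · exact ⟨c, by ext t; simp⟩

end UniformLimits

/-! ### Functions with vanishing averages -/

section MeanZero

variable {ι : Type*} [MeasurableSpace ι]

theorem integrable_of_measurable_bounded {ν : Measure ι} [IsFiniteMeasure ν] {k : ι → ℂ}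
    (hk : Measurable k) (hb : ∃ C : ℝ, ∀ t, ‖k t‖ ≤ C) : Integrable k ν := by
  obtain ⟨C, hC⟩ := hb
  exact Integrable.of_bound hk.aestronglyMeasurable C (Eventually.of_forall hC)

/-- Bounded measurable functions whose integrals tend to zero. -/
def meanZero (ν : ℝ → Measure ι) [∀ T, IsFiniteMeasure (ν T)] : Submodule ℂ (ι → ℂ) where
  carrier := {k | Measurable k ∧ (∃ C : ℝ, ∀ t, ‖k t‖ ≤ C) ∧
    Tendsto (fun T => ∫ t, k t ∂ν T) atTop (𝓝 0)}
  zero_mem' := ⟨measurable_const, ⟨0, by simp⟩, by simp⟩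
  add_mem' := by
    rintro k l ⟨hk, ⟨C, hC⟩, hk0⟩ ⟨hl, ⟨D, hD⟩, hl0⟩
    refine ⟨hk.add hl, ⟨C + D, fun t => (norm_add_le _ _).trans (add_le_add (hC t) (hD t))⟩, ?_⟩
    have := hk0.add hl0
    rw [add_zero] at this
    refine this.congr fun T => ?_
    exact (integral_add (integrable_of_measurable_bounded hk ⟨C, hC⟩)
      (integrable_of_measurable_bounded hl ⟨D, hD⟩)).symm
  smul_mem' := by
    rintro c k ⟨hk, ⟨C, hC⟩, hk0⟩
    refine ⟨hk.const_smul c, ⟨‖c‖ * C, fun t => ?_⟩, ?_⟩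
    · simp only [Pi.smul_apply, smul_eq_mul, norm_mul]
      gcongr
      exact hC t
    · have := hk0.const_mul c
      rw [mul_zero] at this
      refine this.congr fun T => ?_
      simp [integral_const_mul]

/-- Bounded measurable functions whose absolute values have integrals tending to zero. -/
def absMeanZero (ν : ℝ → Measure ι) [∀ T, IsFiniteMeasure (ν T)] : Submodule ℂ (ι → ℂ) where
  carrier := {k | Measurable k ∧ (∃ C : ℝ, ∀ t, ‖k t‖ ≤ C) ∧
    Tendsto (fun T => ∫ t, ‖k t‖ ∂ν T) atTop (𝓝 0)}
  zero_mem' := ⟨measurable_const, ⟨0, by simp⟩, by simp⟩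
  add_mem' := by
    rintro k l ⟨hk, ⟨C, hC⟩, hk0⟩ ⟨hl, ⟨D, hD⟩, hl0⟩
    refine ⟨hk.add hl, ⟨C + D, fun t => (norm_add_le _ _).trans (add_le_add (hC t) (hD t))⟩, ?_⟩
    have := hk0.add hl0
    rw [add_zero] at this
    refine squeeze_zero (fun T => integral_nonneg fun t => norm_nonneg _) (fun T => ?_) this
    have h1 := (integrable_of_measurable_bounded (ν := ν T) hk ⟨C, hC⟩).norm
    have h2 := (integrable_of_measurable_bounded (ν := ν T) hl ⟨D, hD⟩).norm
    rw [← integral_add h1 h2]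
    exact integral_mono_of_nonneg (Eventually.of_forall fun t => norm_nonneg _) (h1.add h2)
      (Eventually.of_forall fun t => norm_add_le _ _)
  smul_mem' := by
    rintro c k ⟨hk, ⟨C, hC⟩, hk0⟩
    refine ⟨hk.const_smul c, ⟨‖c‖ * C, fun t => ?_⟩, ?_⟩
    · simp only [Pi.smul_apply, smul_eq_mul, norm_mul]
      gcongr
      exact hC t
    · have := hk0.const_mul ‖c‖
      rw [mul_zero] at this
      refine this.congr fun T => ?_
      simp [integral_const_mul]

variable {ν : ℝ → Measure ι} [∀ T, IsFiniteMeasure (ν T)]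

theorem measurable_of_uniform_approx {k : ι → ℂ}
    (h : ∀ ε > 0, ∃ k' : ι → ℂ, Measurable k' ∧ ∀ t, ‖k t - k' t‖ ≤ ε) : Measurable k := by
  choose! l hl hkl using h
  refine measurable_of_tendsto_metrizable (f := fun n : ℕ => l (1 / ((n : ℝ) + 1)))
    (fun n => hl _ (by positivity)) (tendsto_pi_nhds.2 fun t => ?_)
  rw [tendsto_iff_norm_sub_tendsto_zero]
  refine squeeze_zero (fun _ => norm_nonneg _) (fun n => ?_) tendsto_one_div_add_atTop_nhds_zero_nat
  rw [norm_sub_rev]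
  exact hkl _ (by positivity) t

theorem bounded_of_uniform_approx {κ : Type*} {k k' : κ → ℂ} {ε : ℝ} (hk' : ∃ C : ℝ, ∀ t, ‖k' t‖ ≤ C)
    (h : ∀ t, ‖k t - k' t‖ ≤ ε) : ∃ C : ℝ, ∀ t, ‖k t‖ ≤ C := by
  obtain ⟨C, hC⟩ := hk'
  refine ⟨ε + C, fun t => ?_⟩
  calc ‖k t‖ = ‖(k t - k' t) + k' t‖ := by simp
    _ ≤ _ := (norm_add_le _ _).trans (add_le_add (h t) (hC t))

/-- In the applications `m T` is the total mass of the averaging measure, which need not equal 1 and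
only tends to 1. -/
theorem tendsto_zero_of_approx {f : ℝ → ℝ} (hf : ∀ T, 0 ≤ f T) {m : ℝ → ℝ}
    (hm : Tendsto m atTop (𝓝 1))
    (h : ∀ ε > 0, ∃ g : ℝ → ℝ, Tendsto g atTop (𝓝 0) ∧ ∀ T, f T ≤ g T + ε * m T) :
    Tendsto f atTop (𝓝 0) := by
  rw [Metric.tendsto_nhds]
  intro ε hε
  obtain ⟨g, hg, hfg⟩ := h (ε / 4) (by positivity)
  filter_upwards [hg.eventually (gt_mem_nhds (show (0 : ℝ) < ε / 4 by positivity)),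
    hm.eventually (gt_mem_nhds (show (1 : ℝ) < 2 by norm_num))] with T h1 h2
  rw [Real.dist_eq, sub_zero, abs_of_nonneg (hf T)]
  nlinarith [hfg T]

theorem uniformlyClosed_meanZero (hν : Tendsto (fun T => (ν T).real Set.univ) atTop (𝓝 1)) :
    UniformlyClosed (meanZero ν) := by
  intro k hk
  have hm : Measurable k := measurable_of_uniform_approx fun ε hε => by
    obtain ⟨k', hk', h⟩ := hk ε hε
    exact ⟨k', hk'.1, h⟩
  have hb : ∃ C : ℝ, ∀ t, ‖k t‖ ≤ C := by
    obtain ⟨k', hk', h⟩ := hk 1 one_pos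
    exact bounded_of_uniform_approx hk'.2.1 h
  refine ⟨hm, hb, ?_⟩
  rw [tendsto_zero_iff_norm_tendsto_zero]
  refine tendsto_zero_of_approx (fun _ => norm_nonneg _) hν fun ε hε => ?_
  obtain ⟨k', hk', h⟩ := hk ε hε
  refine ⟨_, tendsto_zero_iff_norm_tendsto_zero.1 hk'.2.2, fun T => ?_⟩
  have h1 := integrable_of_measurable_bounded (ν := ν T) hm hb
  have h2 := integrable_of_measurable_bounded (ν := ν T) hk'.1 hk'.2.1
  have h3 : ∫ t, k t ∂ν T = ∫ t, k' t ∂ν T + ∫ t, (k t - k' t) ∂ν T := by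
    rw [integral_sub h1 h2]; ring
  rw [h3]
  refine (norm_add_le _ _).trans (add_le_add le_rfl ?_)
  exact norm_integral_le_of_norm_le_const (Eventually.of_forall h)

theorem uniformlyClosed_absMeanZero (hν : Tendsto (fun T => (ν T).real Set.univ) atTop (𝓝 1)) :
    UniformlyClosed (absMeanZero ν) := by
  intro k hk
  have hm : Measurable k := measurable_of_uniform_approx fun ε hε => by
    obtain ⟨k', hk', h⟩ := hk ε hε
    exact ⟨k', hk'.1, h⟩
  have hb : ∃ C : ℝ, ∀ t, ‖k t‖ ≤ C := by
    obtain ⟨k', hk', h⟩ := hk 1 one_pos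
    exact bounded_of_uniform_approx hk'.2.1 h
  refine ⟨hm, hb, ?_⟩
  refine tendsto_zero_of_approx (fun _ => integral_nonneg fun _ => norm_nonneg _) hν
    fun ε hε => ?_
  obtain ⟨k', hk', h⟩ := hk ε hε
  refine ⟨_, hk'.2.2, fun T => ?_⟩
  have h2 := (integrable_of_measurable_bounded (ν := ν T) hk'.1 hk'.2.1).norm
  have h3 : ∫ t, ‖k' t‖ ∂ν T + ε * (ν T).real Set.univ = ∫ t, (‖k' t‖ + ε) ∂ν T := by
    rw [integral_add h2 (integrable_const _), integral_const, smul_eq_mul, mul_comm ε]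
  rw [h3]
  refine integral_mono_of_nonneg (Eventually.of_forall fun t => norm_nonneg _)
    (h2.add (integrable_const _)) (Eventually.of_forall fun t => ?_)
  have := norm_add_le (k' t) (k t - k' t)
  rw [add_sub_cancel] at this
  exact this.trans (add_le_add le_rfl (h t))


end MeanZero

/-! ### Functions vanishing along a sequence -/

section AlongSequence

variable {ι : Type*}

/-- Functions that vanish in the limit along a sequence. -/
def vanishingAlong (τ : ℕ → ι) : Submodule ℂ (ι → ℂ) where
  carrier := {k | Tendsto (fun n => k (τ n)) atTop (𝓝 0)}
  zero_mem' := by simp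
  add_mem' := fun {k l} hk hl => by
    have := Tendsto.add (Set.mem_ofPred.1 hk) (Set.mem_ofPred.1 hl)
    simpa using this
  smul_mem' := fun c k hk => by
    have := Tendsto.const_mul c (Set.mem_ofPred.1 hk)
    simpa using this

theorem uniformlyClosed_vanishingAlong (τ : ℕ → ι) : UniformlyClosed (vanishingAlong τ) := by
  intro k hk
  change Tendsto (fun n => k (τ n)) atTop (𝓝 0)
  rw [Metric.tendsto_nhds]
  intro ε hε
  obtain ⟨k', hk', h⟩ := hk (ε / 2) (by positivity)
  have hk0 : Tendsto (fun n => k' (τ n)) atTop (𝓝 0) := hk'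
  filter_upwards [Metric.tendsto_nhds.1 hk0 (ε / 2) (by positivity)] with n hn
  rw [dist_zero_right] at hn ⊢
  have := norm_add_le (k' (τ n)) (k (τ n) - k' (τ n))
  rw [add_sub_cancel] at this
  linarith [h (τ n)]

end AlongSequence

/-! ### Koopman correlations in `L²` -/

section Correlation

variable {ι E : Type*} [MeasurableSpace E] (μ : Measure E) [IsProbabilityMeasure μ]

/-- The orthogonal projection of `L²` of a probability measure onto the constants. -/
noncomputable def meanProj : Lp ℂ 2 μ →L[ℂ] Lp ℂ 2 μ :=
  (innerSL ℂ (indicatorConstLp 2 MeasurableSet.univ (measure_ne_top μ _) (1 : ℂ))).smulRight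
    (indicatorConstLp 2 MeasurableSet.univ (measure_ne_top μ _) (1 : ℂ))

/-- The centred Koopman operator of a measure preserving map. -/
noncomputable def centredKoopman {S : E → E} (hS : MeasurePreserving S μ μ) :
    Lp ℂ 2 μ →L[ℂ] Lp ℂ 2 μ :=
  (Lp.compMeasurePreservingₗᵢ ℂ S hS).toContinuousLinearMap - meanProj μ

theorem norm_centredKoopman_le {S : E → E} (hS : MeasurePreserving S μ μ) :
    ‖centredKoopman μ hS‖ ≤ 1 + ‖meanProj μ‖ :=
  (norm_sub_le _ _).trans (add_le_add (LinearIsometry.norm_toContinuousLinearMap_le _) le_rfl)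

theorem inner_centredKoopman {S : E → E} (hS : MeasurePreserving S μ μ) {f g : E → ℂ}
    (hf : MemLp f 2 μ) (hg : MemLp g 2 μ) :
    inner ℂ (hf.toLp f) (centredKoopman μ hS (hg.toLp g)) =
      ∫ x, starRingEnd ℂ (f x) * g (S x) ∂μ - starRingEnd ℂ (∫ x, f x ∂μ) * ∫ x, g x ∂μ := by
  have h1 : inner ℂ (hf.toLp f) (Lp.compMeasurePreserving S hS (hg.toLp g)) =
      ∫ x, starRingEnd ℂ (f x) * g (S x) ∂μ := by
    rw [Lp.toLp_compMeasurePreserving hg hS, L2.inner_def]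
    refine integral_congr_ae ?_
    filter_upwards [hf.coeFn_toLp, (hg.comp_measurePreserving hS).coeFn_toLp] with x h1 h2
    rw [h1, h2]
    simp [mul_comm]
  have h2 : ∀ {k : E → ℂ} (hk : MemLp k 2 μ), inner ℂ (indicatorConstLp 2 MeasurableSet.univ
      (measure_ne_top μ _) (1 : ℂ)) (hk.toLp k) = ∫ x, k x ∂μ := by
    intro k hk
    rw [L2.inner_indicatorConstLp_one, setIntegral_univ]
    exact integral_congr_ae hk.coeFn_toLp
  have h3 : centredKoopman μ hS (hg.toLp g) = Lp.compMeasurePreserving S hS (hg.toLp g) -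
      meanProj μ (hg.toLp g) := rfl
  rw [h3, inner_sub_right, h1]
  congr 1
  simp only [meanProj, ContinuousLinearMap.smulRight_apply, innerSL_apply_apply, inner_smul_right]
  rw [h2 hg, ← inner_conj_symm, h2 hf, mul_comm]

/-- Bounded measurable functions as elements of `L²`. -/
theorem memLp_two_of_bounded {f : E → ℂ} (hf : Measurable f) {C : ℝ} (hC : ∀ x, ‖f x‖ ≤ C) :
    MemLp f 2 μ :=
  MemLp.of_bound hf.aestronglyMeasurable C (Eventually.of_forall hC)

theorem memLp_indicator_one {A : Set E} (hA : MeasurableSet A) :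
    MemLp (A.indicator fun _ => (1 : ℂ)) 2 μ :=
  memLp_two_of_bounded μ (measurable_const.indicator hA) (C := 1) fun x => by
    by_cases h : x ∈ A <;> simp [h]

theorem inner_centredKoopman_indicator {S : E → E} (hS : MeasurePreserving S μ μ) {A B : Set E}
    (hA : MeasurableSet A) (hB : MeasurableSet B) :
    inner ℂ ((memLp_indicator_one μ hA).toLp _)
        (centredKoopman μ hS ((memLp_indicator_one μ hB).toLp _)) =
      ((μ.real (A ∩ S ⁻¹' B) - μ.real A * μ.real B : ℝ) : ℂ) := by
  rw [inner_centredKoopman]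
  have h : (fun x => starRingEnd ℂ (A.indicator (fun _ => (1 : ℂ)) x) *
      B.indicator (fun _ => (1 : ℂ)) (S x)) = (A ∩ S ⁻¹' B).indicator fun _ => (1 : ℂ) := by
    ext x
    by_cases h1 : x ∈ A <;> by_cases h2 : S x ∈ B <;> simp [h1, h2]
  rw [h, integral_indicator_const _ (hA.inter (hS.measurable hB)), integral_indicator_const _ hA,
    integral_indicator_const _ hB]
  simp

theorem isTotal_indicator :
    IsTotal {f : Lp ℂ 2 μ | ∃ (A : Set E) (hA : MeasurableSet A),
      f = (memLp_indicator_one μ hA).toLp _} := by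
  intro f hf
  have hi : Integrable f μ := (Lp.memLp f).integrable (by norm_num)
  have h0 : f =ᵐ[μ] 0 := by
    refine hi.ae_eq_zero_of_forall_setIntegral_eq_zero fun A hA _ => ?_
    have := hf _ ⟨A, hA, rfl⟩
    rw [← L2.inner_indicatorConstLp_one (𝕜 := ℂ) hA (measure_ne_top μ _)]
    exact this
  exact (Lp.eq_zero_iff_ae_eq_zero).2 h0

variable [MeasurableSpace ι] {ν : ℝ → Measure ι} [∀ T, IsFiniteMeasure (ν T)]

/-- Ergodicity is the case of two indicators; these are total, so the statement extends to all of
`L²`, in particular to the exponentials. -/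
theorem meanZero_of_indicator {S : ι → E → E} (hS : ∀ t, MeasurePreserving (S t) μ μ)
    (hν : Tendsto (fun T => (ν T).real Set.univ) atTop (𝓝 1))
    (hm : ∀ A B : Set E, MeasurableSet A → MeasurableSet B →
      Measurable fun t => μ.real (A ∩ S t ⁻¹' B))
    (h : ∀ A B : Set E, MeasurableSet A → MeasurableSet B →
      Tendsto (fun T => ∫ t, μ.real (A ∩ S t ⁻¹' B) ∂ν T) atTop (𝓝 (μ.real A * μ.real B)))
    (f g : Lp ℂ 2 μ) : (fun t => inner ℂ f (centredKoopman μ (hS t) g)) ∈ meanZero ν := by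
  refine (uniformlyClosed_meanZero hν).inner_mem (isTotal_indicator μ) _
    (fun t => norm_centredKoopman_le μ (hS t)) ?_ f g
  rintro _ ⟨A, hA, rfl⟩ _ ⟨B, hB, rfl⟩
  have key := funext fun t => inner_centredKoopman_indicator μ (hS t) hA hB
  rw [key]
  refine ⟨?_, ⟨2, fun t => ?_⟩, ?_⟩
  · exact Complex.measurable_ofReal.comp ((hm A B hA hB).sub_const _)
  · rw [Complex.norm_real, Real.norm_eq_abs, abs_le]
    have h1 : μ.real (A ∩ S t ⁻¹' B) ≤ 1 := measureReal_le_one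
    have h2 : μ.real A ≤ 1 := measureReal_le_one
    have h3 : μ.real B ≤ 1 := measureReal_le_one
    have h4 : μ.real A * μ.real B ≤ 1 := mul_le_one₀ h2 measureReal_nonneg h3
    have h5 : 0 ≤ μ.real A * μ.real B := mul_nonneg measureReal_nonneg measureReal_nonneg
    constructor <;> linarith [measureReal_nonneg (μ := μ) (s := A ∩ S t ⁻¹' B)]
  · have h1 := (h A B hA hB).sub (hν.mul_const (μ.real A * μ.real B))
    rw [one_mul, sub_self] at h1
    have h2 := (Complex.continuous_ofReal.tendsto _).comp h1
    rw [Complex.ofReal_zero] at h2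
    refine h2.congr fun T => ?_
    have hi : Integrable (fun t => μ.real (A ∩ S t ⁻¹' B)) (ν T) :=
      Integrable.of_bound (hm A B hA hB).aestronglyMeasurable 1
        (Eventually.of_forall fun t => by
          rw [Real.norm_of_nonneg measureReal_nonneg]; exact measureReal_le_one)
    rw [integral_complex_ofReal, integral_sub hi (integrable_const _), integral_const]
    simp

/-- If the means of `φ` tend to `c` and those of `φ²` tend to `c²`, then `φ` is close to `c` in mean. -/
theorem absMeanZero_of_sq {φ : ι → ℝ} {c : ℝ}
    (hν : Tendsto (fun T => (ν T).real Set.univ) atTop (𝓝 1))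
    (hφ : (fun t => ((φ t - c : ℝ) : ℂ)) ∈ meanZero ν)
    (hψ : (fun t => ((φ t ^ 2 - c ^ 2 : ℝ) : ℂ)) ∈ meanZero ν) :
    (fun t => ((φ t - c : ℝ) : ℂ)) ∈ absMeanZero ν := by
  have hsq : (fun t => (((φ t - c) ^ 2 : ℝ) : ℂ)) ∈ meanZero ν := by
    -- `(φ - c)² = (φ² - c²) - 2c(φ - c)`.
    have := (meanZero ν).sub_mem hψ ((meanZero ν).smul_mem (2 * c : ℂ) hφ)
    convert this using 1
    ext t
    simp only [Pi.sub_apply, Pi.smul_apply, smul_eq_mul]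
    push_cast
    ring
  refine ⟨hφ.1, hφ.2.1, ?_⟩
  have hre := (Complex.continuous_re.tendsto _).comp hsq.2.2
  have h0 : Tendsto (fun T => ∫ t, (φ t - c) ^ 2 ∂ν T) atTop (𝓝 0) := by
    rw [Complex.zero_re] at hre
    refine hre.congr fun T => ?_
    simp only [Function.comp]
    rw [integral_complex_ofReal, Complex.ofReal_re]
  -- The pointwise bound `y ≤ y²/ε + ε` for `y = |φ t - c|` replaces the Cauchy–Schwarz inequality.
  refine tendsto_zero_of_approx (fun _ => integral_nonneg fun _ => norm_nonneg _) hν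
    fun ε hε => ⟨fun T => ε⁻¹ * ∫ t, (φ t - c) ^ 2 ∂ν T, by simpa using h0.const_mul ε⁻¹,
      fun T => ?_⟩
  have hi : Integrable (fun t => (φ t - c) ^ 2) (ν T) := by
    have := (integrable_of_measurable_bounded (ν := ν T) hsq.1 hsq.2.1).re
    simpa only [RCLike.re_to_complex, Complex.ofReal_re] using this
  have h3 : ε⁻¹ * ∫ t, (φ t - c) ^ 2 ∂ν T + ε * (ν T).real Set.univ =
      ∫ t, (ε⁻¹ * (φ t - c) ^ 2 + ε) ∂ν T := by
    rw [integral_add (hi.const_mul _) (integrable_const _), integral_const, smul_eq_mul,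
      mul_comm ε, integral_const_mul]
  rw [h3]
  refine integral_mono_of_nonneg (Eventually.of_forall fun t => norm_nonneg _)
    ((hi.const_mul _).add (integrable_const _)) (Eventually.of_forall fun t => ?_)
  simp only [Complex.norm_real, Real.norm_eq_abs]
  rw [← sq_abs (φ t - c)]
  set y := |φ t - c|
  have h4 : ε⁻¹ * y ^ 2 + ε - y = ε⁻¹ * ((y - ε / 2) ^ 2 + 3 / 4 * ε ^ 2) := by
    field_simp; ring
  have : 0 ≤ ε⁻¹ * ((y - ε / 2) ^ 2 + 3 / 4 * ε ^ 2) := by positivity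
  linarith

end Correlation

/-! ### Totality of the exponentials on path space -/

section Exponentials

variable {J : Type*}

/-- Finite linear combinations of the coordinates of a path. -/
def coordSpan (J : Type*) : Submodule ℝ ((J → ℝ) → ℝ) :=
  Submodule.span ℝ (Set.range fun (s : J) (x : J → ℝ) => x s)

theorem measurable_of_mem_coordSpan {W : (J → ℝ) → ℝ} (hW : W ∈ coordSpan J) : Measurable W := by
  induction hW using Submodule.span_induction with
  | mem _ h => obtain ⟨s, rfl⟩ := h; exact measurable_pi_apply s
  | zero => exact measurable_const
  | add _ _ _ _ h1 h2 => exact h1.add h2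
  | smul c _ _ h => exact h.const_smul c

/-- The function `exp (i W)`. -/
noncomputable def expi (W : (J → ℝ) → ℝ) (x : J → ℝ) : ℂ := Complex.exp (W x * Complex.I)

theorem norm_expi (W : (J → ℝ) → ℝ) (x : J → ℝ) : ‖expi W x‖ = 1 :=
  Complex.norm_exp_ofReal_mul_I _

theorem measurable_expi {W : (J → ℝ) → ℝ} (hW : W ∈ coordSpan J) : Measurable (expi W) := by
  have := measurable_of_mem_coordSpan hW
  unfold expi
  fun_prop

theorem conj_expi (W : (J → ℝ) → ℝ) (x : J → ℝ) : starRingEnd ℂ (expi W x) = expi (-W) x := by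
  simp [expi, ← Complex.exp_conj]

theorem expi_add (W Z : (J → ℝ) → ℝ) (x : J → ℝ) : expi (W + Z) x = expi W x * expi Z x := by
  simp [expi, ← Complex.exp_add, add_mul]

/-- A finite measure on path space is determined by its finite dimensional characteristic
functions. -/
theorem ext_of_integral_expi {ν₁ ν₂ : Measure (J → ℝ)} [IsFiniteMeasure ν₁] [IsFiniteMeasure ν₂]
    (h : ∀ W ∈ coordSpan J, ∫ x, expi W x ∂ν₁ = ∫ x, expi W x ∂ν₂) : ν₁ = ν₂ := by
  refine IsProjectiveLimit.unique (P := fun I : Finset J => ν₂.map I.restrict) (fun I => ?_)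
    (fun I => rfl)
  refine Measure.ext_of_charFunDual ?_
  ext L
  have hmeas : Measurable (I.restrict : (J → ℝ) → (I → ℝ)) := Finset.measurable_restrict I
  have hL : (fun x : J → ℝ => L (I.restrict x)) ∈ coordSpan J := by
    classical
    have : (fun x : J → ℝ => L (I.restrict x)) =
        ∑ j : I, (L (Pi.single j 1)) • fun x : J → ℝ => x j := by
      ext x
      conv_lhs => rw [← Finset.univ_sum_single (I.restrict x)]
      simp only [map_sum, Finset.sum_apply, Pi.smul_apply, smul_eq_mul]
      refine Finset.sum_congr rfl fun j _ => ?_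
      have : (Pi.single j (I.restrict x j) : I → ℝ) = (x j) • Pi.single j 1 := by
        rw [← Pi.single_smul]; simp
      rw [this, map_smul, smul_eq_mul, mul_comm]
    rw [this]
    exact Submodule.sum_mem _ fun j _ =>
      Submodule.smul_mem _ _ (Submodule.subset_span ⟨(j : J), rfl⟩)
  have hc : ∀ ν : Measure (J → ℝ), charFunDual (ν.map I.restrict) L =
      ∫ x, expi (fun x : J → ℝ => L (I.restrict x)) x ∂ν := fun ν => by
    rw [charFunDual_apply, integral_map hmeas.aemeasurable]
    · rfl
    · fun_prop
  rw [hc, hc, h _ hL]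

variable (μ : Measure (J → ℝ))

/-- The finite measures with densities `g⁺` and `g⁻` have the same finite dimensional characteristic
functions, hence coincide, so `g⁺ = g⁻` almost everywhere. -/
theorem ae_eq_zero_of_integral_expi_mul_ofReal {g : (J → ℝ) → ℝ} (hg : Integrable g μ)
    (h : ∀ W ∈ coordSpan J, ∫ x, expi W x * (g x : ℂ) ∂μ = 0) : g =ᵐ[μ] 0 := by
  have hfin : ∀ k : (J → ℝ) → ℝ, Integrable k μ →
      IsFiniteMeasure (μ.withDensity fun x => ENNReal.ofReal (k x)) := fun k hk =>
    isFiniteMeasure_withDensity_ofReal hk.2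
  have := hfin g hg
  have := hfin _ hg.neg
  have hint : ∀ k : (J → ℝ) → ℝ, Integrable k μ → ∀ W : (J → ℝ) → ℝ,
      ∫ x, expi W x ∂(μ.withDensity fun x => ENNReal.ofReal (k x)) =
        ∫ x, expi W x * ((max (k x) 0 : ℝ) : ℂ) ∂μ := by
    intro k hk W
    rw [integral_withDensity_eq_integral_toReal_smul₀ hk.aemeasurable.ennreal_ofReal
      (Eventually.of_forall fun _ => ENNReal.ofReal_lt_top)]
    refine integral_congr_ae (Eventually.of_forall fun x => ?_)
    simp [ENNReal.toReal_ofReal', mul_comm]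
  have heq : (μ.withDensity fun x => ENNReal.ofReal (g x)) =
      μ.withDensity fun x => ENNReal.ofReal ((-g) x) := by
    refine ext_of_integral_expi fun W hW => ?_
    rw [hint g hg, hint _ hg.neg, ← sub_eq_zero]
    have hi : ∀ k : (J → ℝ) → ℝ, Integrable k μ →
        Integrable (fun x => expi W x * ((max (k x) 0 : ℝ) : ℂ)) μ := fun k hk =>
      (hk.pos_part.ofReal (𝕜 := ℂ)).bdd_mul (measurable_expi hW).aestronglyMeasurable (c := 1)
        (Eventually.of_forall fun x => (norm_expi W x).le)
    rw [← integral_sub (hi _ hg) (hi _ hg.neg), ← h W hW]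
    refine integral_congr_ae (Eventually.of_forall fun x => ?_)
    have : max (g x) 0 - max (-g x) 0 = g x := max_zero_sub_max_neg_zero_eq_self _
    simp only [Pi.neg_apply]
    rw [← mul_sub, ← Complex.ofReal_sub, this]
  have hd := (withDensity_eq_iff hg.aemeasurable.ennreal_ofReal hg.neg.aemeasurable.ennreal_ofReal
    (by rw [← setLIntegral_univ, ← withDensity_apply _ MeasurableSet.univ]
        exact measure_ne_top _ _)).1 heq
  filter_upwards [hd] with x hx
  have h1 := congrArg ENNReal.toReal hx
  simp only [ENNReal.toReal_ofReal', Pi.neg_apply] at h1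
  have : max (g x) 0 - max (-g x) 0 = g x := max_zero_sub_max_neg_zero_eq_self _
  rw [Pi.zero_apply, ← this, h1, sub_self]

variable [IsProbabilityMeasure μ]

theorem memLp_expi {W : (J → ℝ) → ℝ} (hW : W ∈ coordSpan J) : MemLp (expi W) 2 μ :=
  memLp_two_of_bounded μ (measurable_expi hW) fun x => (norm_expi W x).le

theorem isTotal_expi :
    IsTotal {f : Lp ℂ 2 μ | ∃ (W : (J → ℝ) → ℝ) (hW : W ∈ coordSpan J),
      f = (memLp_expi μ hW).toLp _} := by
  intro f hf
  have hi : Integrable f μ := (Lp.memLp f).integrable (by norm_num)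
  have hbd : ∀ {W} (_ : W ∈ coordSpan J) {k : (J → ℝ) → ℂ}, Integrable k μ →
      Integrable (fun x => expi W x * k x) μ := fun {W} hW k hk =>
    hk.bdd_mul (measurable_expi hW).aestronglyMeasurable (c := 1)
      (Eventually.of_forall fun x => (norm_expi W x).le)
  have h0 : ∀ W ∈ coordSpan J, ∫ x, expi W x * f x ∂μ = 0 := by
    intro W hW
    rw [← hf _ ⟨-W, (coordSpan J).neg_mem hW, rfl⟩, L2.inner_def]
    refine integral_congr_ae ?_
    filter_upwards [(memLp_expi μ ((coordSpan J).neg_mem hW)).coeFn_toLp] with x hx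
    rw [hx]
    simp [conj_expi, mul_comm]
  -- The exponentials are closed under conjugation, so the conjugate of `f` is annihilated too, and
  -- with it the real and imaginary parts of `f`.
  have h1 : ∀ W ∈ coordSpan J, ∫ x, expi W x * starRingEnd ℂ (f x) ∂μ = 0 := by
    intro W hW
    have := congrArg (starRingEnd ℂ) (h0 (-W) ((coordSpan J).neg_mem hW))
    rw [← integral_conj, map_zero] at this
    rw [← this]
    refine integral_congr_ae (Eventually.of_forall fun x => ?_)
    simp [conj_expi]
  have hic : Integrable (fun x => starRingEnd ℂ (f x)) μ := by
    simpa using (Complex.conjCLE.toContinuousLinearMap.integrable_comp hi)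
  have hre := ae_eq_zero_of_integral_expi_mul_ofReal μ hi.re fun W hW => by
    have e : (fun x => expi W x * ((RCLike.re (f x) : ℝ) : ℂ)) =
        fun x => (1 / 2 : ℂ) * (expi W x * f x + expi W x * starRingEnd ℂ (f x)) := by
      ext x
      have := Complex.add_conj (f x)
      rw [← mul_add, this, RCLike.re_to_complex]
      push_cast
      ring
    rw [e, integral_const_mul, integral_add (hbd hW hi) (hbd hW hic), h0 W hW, h1 W hW]
    simp
  have him := ae_eq_zero_of_integral_expi_mul_ofReal μ hi.im fun W hW => by
    have e : (fun x => expi W x * ((RCLike.im (f x) : ℝ) : ℂ)) =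
        fun x => (-Complex.I / 2 : ℂ) * (expi W x * f x - expi W x * starRingEnd ℂ (f x)) := by
      ext x
      have := Complex.sub_conj (f x)
      rw [← mul_sub, this, RCLike.im_to_complex]
      push_cast
      linear_combination (expi W x * ((f x).im : ℂ)) * Complex.I_sq
    rw [e, integral_const_mul, integral_sub (hbd hW hi) (hbd hW hic), h0 W hW, h1 W hW]
    simp
  refine (Lp.eq_zero_iff_ae_eq_zero).2 ?_
  filter_upwards [hre, him] with x h2 h3
  exact Complex.ext h2 h3

end Exponentials

/-! ### The squaring identity of stable laws -/

section Stable

variable {J : Type*} (μ : Measure (J → ℝ))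

theorem integral_expi_eq_charFun {W : (J → ℝ) → ℝ} (hW : W ∈ coordSpan J) (u : ℝ) :
    ∫ x, expi (u • W) x ∂μ = charFun (μ.map W) u := by
  rw [charFun_apply_real, integral_map (measurable_of_mem_coordSpan hW).aemeasurable (by fun_prop)]
  simp [expi]

/-- Rescaling a symmetric stable vector by `2 ^ (1 / α)` squares its characteristic function. -/
theorem integral_expi_smul_of_isSaSLaw {α : ℝ} (hα : 0 < α) {W : (J → ℝ) → ℝ}
    (hW : W ∈ coordSpan J) (h : IsSaSLaw α (μ.map W)) :
    ∃ r : ℝ, ∫ x, expi W x ∂μ = r ∧ ∫ x, expi (((2 : ℝ) ^ α⁻¹) • W) x ∂μ = ((r ^ 2 : ℝ) : ℂ) := by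
  obtain ⟨σ, -, hσ⟩ := h
  refine ⟨Real.exp (-σ ^ α), ?_, ?_⟩
  · have := integral_expi_eq_charFun μ hW 1
    rw [one_smul] at this
    rw [this, hσ]
    simp
  · rw [integral_expi_eq_charFun μ hW, hσ, abs_of_pos (by positivity),
      ← Real.rpow_mul (by norm_num), inv_mul_cancel₀ hα.ne', Real.rpow_one, ← Real.exp_nat_mul]
    congr 2
    push_cast
    ring

variable [IsProbabilityMeasure μ]
variable {ι : Type*} [MeasurableSpace ι] {ν : ℝ → Measure ι} [∀ T, IsFiniteMeasure (ν T)]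

/-- The product of `exp(-iZ)` and `exp(iY ∘ S)` is a single exponential, so the correlation involves
only characteristic function values; these being real, no conjugate survives. -/
theorem inner_centredKoopman_expi {S : (J → ℝ) → (J → ℝ)} (hS : MeasurePreserving S μ μ)
    {Y Z : (J → ℝ) → ℝ} (hY : Y ∈ coordSpan J) (hZ : Z ∈ coordSpan J) {φ c d : ℝ}
    (hφ : ∫ x, expi (Y ∘ S - Z) x ∂μ = φ) (hc : ∫ x, expi Z x ∂μ = c)
    (hd : ∫ x, expi Y x ∂μ = d) :
    inner ℂ ((memLp_expi μ hZ).toLp _) (centredKoopman μ hS ((memLp_expi μ hY).toLp _)) =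
      ((φ - c * d : ℝ) : ℂ) := by
  rw [inner_centredKoopman, hc, hd]
  have : (fun x => starRingEnd ℂ (expi Z x) * expi Y (S x)) = expi (Y ∘ S - Z) := by
    ext x
    rw [sub_eq_add_neg, expi_add, conj_expi, mul_comm]
    rfl
  rw [this, hφ]
  simp

/-- For a stable law on path space, vanishing mean correlations vanish in absolute mean. -/
theorem absMeanZero_of_isSaSLaw {α : ℝ} (hα : 0 < α)
    (hlaw : ∀ W ∈ coordSpan J, IsSaSLaw α (μ.map W))
    {S : ι → (J → ℝ) → (J → ℝ)} (hS : ∀ t, MeasurePreserving (S t) μ μ)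
    (hcoord : ∀ t, ∀ W ∈ coordSpan J, W ∘ S t ∈ coordSpan J)
    (hν : Tendsto (fun T => (ν T).real Set.univ) atTop (𝓝 1))
    (h : ∀ f g : Lp ℂ 2 μ, (fun t => inner ℂ f (centredKoopman μ (hS t) g)) ∈ meanZero ν)
    (f g : Lp ℂ 2 μ) : (fun t => inner ℂ f (centredKoopman μ (hS t) g)) ∈ absMeanZero ν := by
  refine (uniformlyClosed_absMeanZero hν).inner_mem (isTotal_expi μ) _
    (fun t => norm_centredKoopman_le μ (hS t)) ?_ f g
  rintro _ ⟨Z, hZ, rfl⟩ _ ⟨Y, hY, rfl⟩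
  have hsub : ∀ t, Y ∘ S t - Z ∈ coordSpan J := fun t =>
    (coordSpan J).sub_mem (hcoord t Y hY) hZ
  -- Since `q^α = 2`, scaling by `q` doubles the exponent `-σ^α`. As `q(Y ∘ S t - Z) = (qY) ∘ S t -
  -- qZ`, the square of `φ` comes from the correlation of another pair of exponentials.
  set q : ℝ := (2 : ℝ) ^ α⁻¹
  choose φ hφ hφ2 using fun t => integral_expi_smul_of_isSaSLaw μ hα (hsub t) (hlaw _ (hsub t))
  obtain ⟨c, hc, hc2⟩ := integral_expi_smul_of_isSaSLaw μ hα hZ (hlaw _ hZ)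
  obtain ⟨d, hd, hd2⟩ := integral_expi_smul_of_isSaSLaw μ hα hY (hlaw _ hY)
  have h1 := h ((memLp_expi μ hZ).toLp _) ((memLp_expi μ hY).toLp _)
  have hqY := (coordSpan J).smul_mem q hY
  have hqZ := (coordSpan J).smul_mem q hZ
  have h2 := h ((memLp_expi μ hqZ).toLp _) ((memLp_expi μ hqY).toLp _)
  have e1 := funext fun t => inner_centredKoopman_expi μ (hS t) hY hZ (hφ t) hc hd
  have e2 := funext fun t => inner_centredKoopman_expi μ (hS t) hqY hqZ (φ := φ t ^ 2)
    (by rw [← hφ2 t, smul_sub]; rfl) hc2 hd2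
  rw [e1] at h1 ⊢
  rw [e2] at h2
  simp only [← mul_pow] at h2
  exact absMeanZero_of_sq hν h1 h2

end Stable

/-! ### Separability of `L²` of the law -/

section Separability

/-- The slices of a jointly measurable set lie in a countably generated `σ`-algebra. -/
theorem exists_countable_slices {ι Ω : Type*} [MeasurableSpace ι] [MeasurableSpace Ω]
    {s : Set (ι × Ω)} (hs : MeasurableSet s) :
    ∃ C : Set (Set Ω), C.Countable ∧ (∀ c ∈ C, MeasurableSet c) ∧
      ∀ t, MeasurableSet[MeasurableSpace.generateFrom C] (Prod.mk t ⁻¹' s) := by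
  rw [← generateFrom_prod] at hs
  induction s, hs using MeasurableSpace.generateFrom_induction with
  | hC s hs _ =>
    obtain ⟨A, hA, B, hB, rfl⟩ := hs
    refine ⟨{B}, Set.countable_singleton B, by simpa using hB, fun t => ?_⟩
    by_cases ht : t ∈ A
    · rw [Set.mk_preimage_prod_right ht]
      exact MeasurableSpace.measurableSet_generateFrom rfl
    · rw [Set.mk_preimage_prod_right_eq_empty ht]
      exact @MeasurableSet.empty _ (_)
  | empty => exact ⟨∅, Set.countable_empty, by simp, fun t => by simp⟩
  | compl s _ h =>
    obtain ⟨C, hC, hm, h⟩ := h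
    exact ⟨C, hC, hm, fun t => (h t).compl⟩
  | iUnion s _ h =>
    choose C hC hm h using h
    refine ⟨⋃ n, C n, Set.countable_iUnion hC, fun c hc => ?_, fun t => ?_⟩
    · obtain ⟨n, hn⟩ := Set.mem_iUnion.1 hc
      exact hm n c hn
    · rw [Set.preimage_iUnion]
      exact MeasurableSet.iUnion fun n =>
        MeasurableSpace.generateFrom_mono (Set.subset_iUnion C n) _ (h n t)

/-- The variables of a jointly measurable field are measurable for one countably generated
`σ`-algebra. -/
theorem exists_countablyGenerated {ι Ω : Type*} [MeasurableSpace ι] [mΩ : MeasurableSpace Ω]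
    {F : ι × Ω → ℝ} (hF : Measurable F) :
    ∃ m : MeasurableSpace Ω, m ≤ mΩ ∧ @MeasurableSpace.CountablyGenerated Ω m ∧
      ∀ t, Measurable[m] fun ω => F (t, ω) := by
  obtain ⟨b, hb, hgen⟩ := MeasurableSpace.CountablyGenerated.isCountablyGenerated (α := ℝ)
  have hbm : ∀ s ∈ b, MeasurableSet s := fun s hs => by
    rw [hgen]; exact MeasurableSpace.measurableSet_generateFrom hs
  choose! C hC hm h using fun s (hs : s ∈ b) => exists_countable_slices (hF (hbm s hs))
  refine ⟨MeasurableSpace.generateFrom (⋃ s ∈ b, C s), ?_,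
    @MeasurableSpace.CountablyGenerated.mk Ω (_) ⟨_, hb.biUnion hC, rfl⟩, fun t => ?_⟩
  · refine MeasurableSpace.generateFrom_le fun c hc => ?_
    obtain ⟨s, hs, hc⟩ := Set.mem_iUnion₂.1 hc
    exact hm s hs c hc
  · rw [hgen]
    refine @measurable_generateFrom _ _ (_) _ _ fun s hs => ?_
    exact MeasurableSpace.generateFrom_mono (Set.subset_biUnion_of_mem hs) _ (h s hs t)

/-- Composition with `X` embeds `L²(μ)` isometrically into `L²(P)`, which is separable because the
`σ`-algebra of `Ω` is countably generated. Nothing of the kind is asked of `E`, here an uncountable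
product when `𝕋 = ℝ`. -/
theorem secondCountable_Lp_of_measurePreserving {Ω E : Type*} [MeasurableSpace Ω]
    [MeasurableSpace.CountablyGenerated Ω] [MeasurableSpace E] {P : Measure Ω}
    [IsFiniteMeasure P] {μ : Measure E} {X : Ω → E} (hX : MeasurePreserving X P μ) :
    SecondCountableTopology (Lp ℂ 2 μ) :=
  have : Fact ((2 : ENNReal) ≠ ⊤) := ⟨by norm_num⟩
  have h : Isometry (Lp.compMeasurePreserving (E := ℂ) (p := 2) X hX) :=
    Lp.isometry_compMeasurePreserving hX
  h.isUniformInducing.isInducing.secondCountableTopology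

theorem measurePreserving_trim {Ω E : Type*} {m mΩ : MeasurableSpace Ω} [MeasurableSpace E]
    (hm : m ≤ mΩ) (P : @Measure Ω mΩ) {X : Ω → E} (hX : @Measurable Ω E m _ X) :
    @MeasurePreserving Ω E m _ X (P.trim hm) (@Measure.map Ω E mΩ _ X P) := by
  refine @MeasurePreserving.mk Ω E m _ X (P.trim hm) _ hX (Measure.ext fun s hs => ?_)
  rw [@Measure.map_apply Ω E m _ (P.trim hm) X hX s hs,
    @Measure.map_apply Ω E mΩ _ P X (fun t ht => hm _ (hX ht)) s hs,
    trim_measurableSet_eq hm (hX hs)]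

/-- The space `L²` of the law of a jointly measurable field is separable. -/
theorem secondCountable_Lp_law {ι Ω : Type*} [MeasurableSpace ι] [mΩ : MeasurableSpace Ω]
    (P : Measure Ω) [IsProbabilityMeasure P] {X : ι → Ω → ℝ}
    (hX : Measurable fun p : ι × Ω => X p.1 p.2) :
    SecondCountableTopology (Lp ℂ 2 (P.map fun ω s => X s ω)) := by
  obtain ⟨m, hm, hcg, h⟩ := exists_countablyGenerated hX
  have hXm : Measurable[m] fun ω s => X s ω := @measurable_pi_lambda _ _ _ m _ _ h
  exact @secondCountable_Lp_of_measurePreserving Ω _ m hcg _ (P.trim hm)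
    (isFiniteMeasure_trim hm) _ _
    (measurePreserving_trim hm P hXm)

end Separability

/-! ### From vanishing averages to a density one set -/

section DensityOne

theorem exists_antitone_majorant {f : ℝ → ℝ} (hf : Tendsto f atTop (𝓝 0)) :
    ∃ a : ℝ → ℝ, Antitone a ∧ (∀ T, 0 < a T) ∧ (∀ᶠ T in atTop, f T ≤ a T) ∧
      Tendsto a atTop (𝓝 0) := by
  have hb : ∀ ε > 0, ∃ R, ∀ T ≥ R, |f T| ≤ ε := fun ε hε => by
    obtain ⟨R, hR⟩ := eventually_atTop.1 (Metric.tendsto_nhds.1 hf ε hε)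
    exact ⟨R, fun T hT => by simpa [Real.dist_eq] using (hR T hT).le⟩
  obtain ⟨R, hR⟩ := hb 1 one_pos
  have hbdd : ∀ T, BddAbove (Set.range fun s : Set.Ici (max T R) => |f s|) := fun T => by
    refine ⟨1, ?_⟩
    rintro _ ⟨s, rfl⟩
    exact hR s ((le_max_right _ _).trans s.2)
  have hnn : ∀ T, 0 ≤ ⨆ s : Set.Ici (max T R), |f s| := fun T =>
    Real.iSup_nonneg fun s => abs_nonneg _
  -- Cutting off at `R`, beyond which `|f| ≤ 1`, keeps the supremum finite; the exponential makes
  -- the majorant strictly positive.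
  refine ⟨fun T => (⨆ s : Set.Ici (max T R), |f s|) + Real.exp (-T), ?_, fun T => ?_, ?_, ?_⟩
  · intro T T' hT
    refine add_le_add ?_ (Real.exp_le_exp.2 (neg_le_neg hT))
    have : Nonempty (Set.Ici (max T' R)) := Set.nonempty_Ici.to_subtype
    refine ciSup_le fun s => ?_
    exact le_ciSup (hbdd T) ⟨s, (max_le_max_right R hT).trans s.2⟩
  · exact add_pos_of_nonneg_of_pos (hnn T) (Real.exp_pos _)
  · filter_upwards [eventually_ge_atTop R] with T hT
    have h1 := le_ciSup (hbdd T) ⟨T, max_le le_rfl hT⟩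
    have h2 := Real.exp_pos (-T)
    have h3 := le_abs_self (f T)
    simp only at h1
    linarith
  · have h1 : Tendsto (fun T => ⨆ s : Set.Ici (max T R), |f s|) atTop (𝓝 0) := by
      rw [Metric.tendsto_nhds]
      intro ε hε
      obtain ⟨R', hR'⟩ := hb (ε / 2) (by positivity)
      filter_upwards [eventually_ge_atTop R'] with T hT
      have : Nonempty (Set.Ici (max T R)) := Set.nonempty_Ici.to_subtype
      have : ⨆ s : Set.Ici (max T R), |f s| ≤ ε / 2 :=
        ciSup_le fun s => hR' s (hT.trans ((le_max_left _ _).trans s.2))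
      rw [Real.dist_eq, sub_zero, abs_of_nonneg (hnn T)]
      linarith
    simpa using h1.add (Real.tendsto_exp_neg_atTop_nhds_zero)

variable {ι : Type*} [MeasurableSpace ι] {ν : ℝ → Measure ι} [∀ T, IsFiniteMeasure (ν T)]

/-- A nonnegative function with vanishing means vanishes at infinity along a set of density one. -/
theorem exists_full_density_set {u : ι → ℝ} (hu : Measurable u) (hu0 : ∀ t, 0 ≤ u t) {C : ℝ}
    (hC : ∀ t, u t ≤ C) (hlim : Tendsto (fun T => ∫ t, u t ∂ν T) atTop (𝓝 0)) {size : ι → ℝ}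
    (hsize : Measurable size) (hsupp : ∀ᶠ T in atTop, ∀ᵐ t ∂ν T, size t ≤ T) :
    ∃ D : Set ι, MeasurableSet D ∧ Tendsto (fun T => (ν T).real Dᶜ) atTop (𝓝 0) ∧
      ∀ τ : ℕ → ι, (∀ n, τ n ∈ D) → Tendsto (fun n => size (τ n)) atTop atTop →
        Tendsto (fun n => u (τ n)) atTop (𝓝 0) := by
  obtain ⟨a, ha, hpos, hle, ha0⟩ := exists_antitone_majorant hlim
  have hsq : Tendsto (fun T => Real.sqrt (a T)) atTop (𝓝 0) := by
    have := (Real.continuous_sqrt.tendsto 0).comp ha0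
    rwa [Real.sqrt_zero] at this
  -- Where `size t ≤ T`, a point outside this set has `u t > √(a T)` because `a` is antitone, and
  -- Markov's inequality bounds the mass of such points by `a T / √(a T) = √(a T)`.
  refine ⟨{t | u t ≤ Real.sqrt (a (size t))},
    measurableSet_le hu (ha.measurable.comp hsize).sqrt, ?_, fun τ hτ hinf => ?_⟩
  · refine squeeze_zero' (Eventually.of_forall fun _ => measureReal_nonneg) ?_ hsq
    filter_upwards [hsupp, hle] with T hT hlT
    have hs : 0 < Real.sqrt (a T) := Real.sqrt_pos.2 (hpos T)
    have h1 : (ν T).real {t | u t ≤ Real.sqrt (a (size t))}ᶜ ≤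
        (ν T).real {t | Real.sqrt (a T) ≤ u t} := by
      refine ENNReal.toReal_mono (measure_ne_top _ _) (measure_mono_ae ?_)
      filter_upwards [hT] with t ht h
      have h' : ¬ u t ≤ Real.sqrt (a (size t)) := h
      exact (Real.sqrt_le_sqrt (ha ht)).trans (not_le.1 h').le
    have hi : Integrable u (ν T) := Integrable.of_bound hu.aestronglyMeasurable C
      (Eventually.of_forall fun t => by rw [Real.norm_of_nonneg (hu0 t)]; exact hC t)
    have h2 := mul_meas_ge_le_integral_of_nonneg (Eventually.of_forall hu0) hi (Real.sqrt (a T))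
    have h3 : Real.sqrt (a T) * Real.sqrt (a T) = a T := Real.mul_self_sqrt (hpos T).le
    refine h1.trans (le_of_mul_le_mul_left ?_ hs)
    rw [h3]
    exact h2.trans hlT
  · exact squeeze_zero (fun n => hu0 _) (fun n => hτ n) (hsq.comp hinf)

/-- Countably many functions with vanishing absolute means are controlled by a single one. -/
theorem exists_common_majorant (hν : Tendsto (fun T => (ν T).real Set.univ) atTop (𝓝 1))
    {k : ℕ → ι → ℂ} (hk : ∀ j, k j ∈ absMeanZero ν) :
    ∃ u : ι → ℝ, Measurable u ∧ (∀ t, 0 ≤ u t) ∧ (∀ t, u t ≤ 1) ∧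
      Tendsto (fun T => ∫ t, u t ∂ν T) atTop (𝓝 0) ∧
      ∀ τ : ℕ → ι, Tendsto (fun n => u (τ n)) atTop (𝓝 0) →
        ∀ j, Tendsto (fun n => k j (τ n)) atTop (𝓝 0) := by
  have hone : ∀ j : ℕ, (1 : ℝ) / (j + 1) ≤ 1 := fun j => by
    rw [div_le_one (by positivity)]; linarith [Nat.cast_nonneg (α := ℝ) j]
  have hbdd : ∀ t, BddAbove (Set.range fun j : ℕ => min ‖k j t‖ (1 / ((j : ℝ) + 1))) := fun t => by
    refine ⟨1, ?_⟩
    rintro _ ⟨j, rfl⟩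
    exact (min_le_right _ _).trans (hone j)
  have hnn : ∀ t, 0 ≤ ⨆ j : ℕ, min ‖k j t‖ (1 / ((j : ℝ) + 1)) := fun t =>
    Real.iSup_nonneg fun j => le_min (norm_nonneg _) (by positivity)
  have hmeas : Measurable fun t => ⨆ j : ℕ, min ‖k j t‖ (1 / ((j : ℝ) + 1)) :=
    Measurable.iSup fun j => (hk j).1.norm.min measurable_const
  -- Truncating the `j`-th function at `1/(j+1)` makes all but the first `N` of them smaller than
  -- `ε`, so the supremum is at most a finite sum plus `ε`.
  refine ⟨fun t => ⨆ j : ℕ, min ‖k j t‖ (1 / ((j : ℝ) + 1)), hmeas, hnn,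
    fun t => ciSup_le fun j => (min_le_right _ _).trans (hone j), ?_, fun τ hτ j => ?_⟩
  · refine tendsto_zero_of_approx (fun _ => integral_nonneg hnn) hν fun ε hε => ?_
    obtain ⟨N, hN⟩ := exists_nat_one_div_lt hε
    refine ⟨fun T => ∑ j ∈ Finset.range N, ∫ t, ‖k j t‖ ∂ν T, ?_, fun T => ?_⟩
    · simpa using tendsto_finsetSum (Finset.range N) fun j _ => (hk j).2.2
    · have hi : ∀ j, Integrable (fun t => ‖k j t‖) (ν T) := fun j =>
        (integrable_of_measurable_bounded (hk j).1 (hk j).2.1).norm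
      have hi' := integrable_finsetSum (μ := ν T) (Finset.range N) fun j _ => hi j
      have h3 : ∑ j ∈ Finset.range N, ∫ t, ‖k j t‖ ∂ν T + ε * (ν T).real Set.univ =
          ∫ t, (∑ j ∈ Finset.range N, ‖k j t‖ + ε) ∂ν T := by
        rw [integral_add hi' (integrable_const _), integral_const, smul_eq_mul, mul_comm ε,
          integral_finsetSum _ fun j _ => hi j]
      rw [h3]
      refine integral_mono_of_nonneg (Eventually.of_forall hnn) (hi'.add (integrable_const _))
        (Eventually.of_forall fun t => ciSup_le fun j => ?_)
      have hs : 0 ≤ ∑ j ∈ Finset.range N, ‖k j t‖ := Finset.sum_nonneg fun _ _ => norm_nonneg _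
      by_cases hj : j < N
      · have := Finset.single_le_sum (f := fun j => ‖k j t‖) (fun _ _ => norm_nonneg _)
          (Finset.mem_range.2 hj)
        have h4 := min_le_left ‖k j t‖ (1 / ((j : ℝ) + 1))
        exact h4.trans (by simpa using this.trans (le_add_of_nonneg_right hε.le))
      · have h4 := min_le_right ‖k j t‖ (1 / ((j : ℝ) + 1))
        have h5 : (1 : ℝ) / (j + 1) ≤ 1 / (N + 1) := by
          gcongr
          exact not_lt.1 hj
        linarith
  · rw [Metric.tendsto_nhds] at hτ ⊢
    intro ε hε
    -- Once the supremum is below `1/(j+1)`, the truncation of the `j`-th function is inactive.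
    have hjpos : (0 : ℝ) < 1 / ((j : ℝ) + 1) := by positivity
    filter_upwards [hτ (min ε (1 / ((j : ℝ) + 1))) (lt_min hε hjpos)] with n hn
    rw [Real.dist_eq, sub_zero, abs_of_nonneg (hnn _)] at hn
    have h1 := (le_ciSup (hbdd (τ n)) j).trans_lt hn
    rw [dist_zero_right]
    have h2 : ‖k j (τ n)‖ < 1 / ((j : ℝ) + 1) :=
      (min_lt_iff.1 (h1.trans_le (min_le_right _ _))).resolve_right (lt_irrefl _)
    rw [min_eq_left h2.le] at h1
    exact h1.trans_le (min_le_left _ _)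

end DensityOne

/-! ### Translations of paths and the law of the field -/

section PathSpace

variable {G : Type*} [AddCommGroup G]

/-- The translation of paths, whose inverse images are the translates of events. -/
def shift (t : G) (x : G → ℝ) : G → ℝ := fun s => x (s - t)

theorem measurable_shift (t : G) : Measurable (shift t) :=
  measurable_pi_lambda _ fun s => measurable_pi_apply (s - t)

theorem comp_shift_mem_coordSpan (t : G) {W : (G → ℝ) → ℝ} (hW : W ∈ coordSpan G) :
    W ∘ shift t ∈ coordSpan G := by
  induction hW using Submodule.span_induction with
  | mem _ h =>
    obtain ⟨s, rfl⟩ := h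
    exact Submodule.subset_span ⟨s - t, rfl⟩
  | zero => exact (coordSpan G).zero_mem
  | add _ _ _ _ h1 h2 => exact (coordSpan G).add_mem h1 h2
  | smul c _ _ h => exact (coordSpan G).smul_mem c h

end PathSpace

section Law

variable {𝕋 : Type} [NormedAddCommGroup 𝕋] [MeasurableSpace 𝕋] {d : ℕ}
variable {Ω : Type*} [MeasurableSpace Ω] {P : Measure Ω} {X : (Fin d → 𝕋) → Ω → ℝ}

theorem IsMeasurableField.measurable_path (hX : IsMeasurableField X) :
    Measurable fun ω s => X s ω :=
  measurable_pi_lambda _ fun _ =>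
    Measurable.comp (g := fun p : (Fin d → 𝕋) × Ω => X p.1 p.2) hX measurable_prodMk_left

theorem measurePreserving_shift (hX : IsMeasurableField X) (hs : IsStationary P X)
    (t : Fin d → 𝕋) :
    MeasurePreserving (shift t) (P.map fun ω s => X s ω) (P.map fun ω s => X s ω) := by
  refine ⟨measurable_shift t, ?_⟩
  rw [Measure.map_map (measurable_shift t) hX.measurable_path]
  -- `shift t` carries the path of `X` to `s ↦ X (s - t)`, the translate by `-t`.
  have := hs (-t)
  simp only [← sub_eq_add_neg] at this
  exact this

theorem isSaSLaw_of_mem_coordSpan {α : ℝ} (hX : IsMeasurableField X) (hα : IsSaSField α P X)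
    {W : ((Fin d → 𝕋) → ℝ) → ℝ} (hW : W ∈ coordSpan (Fin d → 𝕋)) :
    IsSaSLaw α ((P.map fun ω s => X s ω).map W) := by
  rw [Measure.map_map (measurable_of_mem_coordSpan hW) hX.measurable_path]
  obtain ⟨n, c, g, rfl⟩ := Submodule.mem_span_set'.1 hW
  choose s hs using fun i => (g i).2
  convert hα n s c using 2
  ext ω
  simp [← hs]

theorem real_inter_translate (hX : IsMeasurableField X) (t : Fin d → 𝕋)
    {A B : Set ((Fin d → 𝕋) → ℝ)} (hA : MeasurableSet A) (hB : MeasurableSet B) :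
    (P.map fun ω s => X s ω).real (A ∩ shift t ⁻¹' B) =
      P.real (pathEvent X A ∩ translate X t B) :=
  map_measureReal_apply hX.measurable_path (hA.inter (measurable_shift t hB))

theorem real_pathEvent (hX : IsMeasurableField X) {A : Set ((Fin d → 𝕋) → ℝ)}
    (hA : MeasurableSet A) : (P.map fun ω s => X s ω).real A = P.real (pathEvent X A) :=
  map_measureReal_apply hX.measurable_path hA

theorem measurable_real_inter_translate [MeasurableSub 𝕋] [IsProbabilityMeasure P]
    (hX : IsMeasurableField X) {A B : Set ((Fin d → 𝕋) → ℝ)} (hA : MeasurableSet A)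
    (hB : MeasurableSet B) :
    Measurable fun t => P.real (pathEvent X A ∩ translate X t B) := by
  have h1 : Measurable fun p : (Fin d → 𝕋) × Ω => fun s => X s p.2 :=
    hX.measurable_path.comp measurable_snd
  have h2 : Measurable fun p : (Fin d → 𝕋) × Ω => fun s => X (s - p.1) p.2 :=
    measurable_pi_lambda _ fun s =>
      Measurable.comp hX ((measurable_fst.const_sub s).prodMk measurable_snd)
  exact (measurable_measure_prodMk_left ((h1 hA).inter (h2 hB))).ennreal_toReal

end Law

/-! ### Averages over boxes -/

section Averages

variable {𝕋 : Type} [MeasurableSpace 𝕋] [Axis 𝕋] {d : ℕ}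

/-- The normalised restriction of the reference measure to a box. -/
noncomputable def boxMeasure (𝕋 : Type) [MeasurableSpace 𝕋] [Axis 𝕋] (d : ℕ) (T : ℝ) :
    Measure (Fin d → 𝕋) :=
  ENNReal.ofReal ((2 * T) ^ d)⁻¹ • (Axis.refMeasure d).restrict (box 𝕋 d T)

theorem average_eq_integral {T : ℝ} (hT : 0 ≤ T) (h : (Fin d → 𝕋) → ℝ) :
    average T h = ∫ t, h t ∂boxMeasure 𝕋 d T := by
  rw [boxMeasure, integral_smul_measure, ENNReal.toReal_ofReal (by positivity)]
  rfl

theorem average_eventuallyEq (h : (Fin d → 𝕋) → ℝ) :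
    (fun T => average T h) =ᶠ[atTop] fun T => ∫ t, h t ∂boxMeasure 𝕋 d T := by
  filter_upwards [eventually_ge_atTop 0] with T hT using average_eq_integral hT h

theorem hasDensityOne_iff {D : Set (Fin d → 𝕋)} (hD : MeasurableSet D) :
    HasDensityOne D ↔ Tendsto (fun T => (boxMeasure 𝕋 d T).real Dᶜ) atTop (𝓝 0) := by
  have h : ∀ T, ∫ t, Dᶜ.indicator (fun _ => (1 : ℝ)) t ∂boxMeasure 𝕋 d T =
      (boxMeasure 𝕋 d T).real Dᶜ := fun T => integral_indicator_one hD.compl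
  rw [HasDensityOne, HasDensityZero, and_iff_right hD.compl,
    tendsto_congr' (average_eventuallyEq _)]
  simp only [h]

end Averages

section Boxes

variable {𝕋 : Type} [NormedAddCommGroup 𝕋] [MeasurableSpace 𝕋] [Axis 𝕋]

/-- The properties of an axis that the ergodic theory depends on. -/
structure IsRegularAxis (𝕋 : Type) [NormedAddCommGroup 𝕋] [MeasurableSpace 𝕋] [Axis 𝕋]
    (d : ℕ) : Prop where
  measurable_toReal : Measurable (Axis.toReal : 𝕋 → ℝ)
  norm_eq : ∀ x : 𝕋, ‖x‖ = |Axis.toReal x|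
  finite_box : ∀ T, Axis.refMeasure d (box 𝕋 d T) < ⊤
  tendsto_mass : Tendsto (fun T => average T fun _ : Fin d → 𝕋 => (1 : ℝ)) atTop (𝓝 1)

variable {d : ℕ}

theorem IsRegularAxis.isFiniteMeasure (hr : IsRegularAxis 𝕋 d) (T : ℝ) :
    IsFiniteMeasure (boxMeasure 𝕋 d T) := by
  have : IsFiniteMeasure ((Axis.refMeasure d).restrict (box 𝕋 d T)) :=
    ⟨by rw [Measure.restrict_apply_univ]; exact hr.finite_box T⟩
  exact Measure.smul_finite _ ENNReal.ofReal_ne_top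

theorem IsRegularAxis.tendsto_real_univ (hr : IsRegularAxis 𝕋 d) :
    Tendsto (fun T => (boxMeasure 𝕋 d T).real Set.univ) atTop (𝓝 1) := by
  refine (hr.tendsto_mass.congr' (average_eventuallyEq _)).congr fun T => ?_
  rw [integral_const, smul_eq_mul, mul_one]

theorem IsRegularAxis.measurableSet_box (hr : IsRegularAxis 𝕋 d) (T : ℝ) :
    MeasurableSet (box 𝕋 d T) := by
  simp only [box, Set.ofPred_forall]
  exact MeasurableSet.iInter fun i =>
    (hr.measurable_toReal.comp (measurable_pi_apply i)) measurableSet_Ioc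

theorem IsRegularAxis.ae_norm_le (hr : IsRegularAxis 𝕋 d) {T : ℝ} (hT : 0 ≤ T) :
    ∀ᵐ t ∂boxMeasure 𝕋 d T, ‖t‖ ≤ T := by
  refine Measure.ae_smul_measure (ae_restrict_of_forall_mem (hr.measurableSet_box T)
    fun t ht => ?_) _
  refine (pi_norm_le_iff_of_nonneg hT).2 fun i => ?_
  rw [hr.norm_eq]
  exact abs_le.2 ⟨(ht i).1.le, (ht i).2⟩

/-- The ball lies in the fixed box of radius `R`, of finite measure, while the normalisation
`(2T)^d` tends to infinity because `d ≥ 1`. -/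
theorem IsRegularAxis.tendsto_real_ball (hr : IsRegularAxis 𝕋 d) (hd : 1 ≤ d) (R : ℝ) :
    Tendsto (fun T => (boxMeasure 𝕋 d T).real {t | ‖t‖ < R}) atTop (𝓝 0) := by
  have hlim : Tendsto (fun T : ℝ => ((2 * T) ^ d)⁻¹ * (Axis.refMeasure d).real (box 𝕋 d R))
      atTop (𝓝 0) := by
    have h1 : Tendsto (fun T : ℝ => (2 * T) ^ d) atTop atTop :=
      (tendsto_pow_atTop (by omega)).comp (tendsto_id.const_mul_atTop two_pos)
    simpa using h1.inv_tendsto_atTop.mul_const ((Axis.refMeasure d).real (box 𝕋 d R))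
  refine squeeze_zero' (Eventually.of_forall fun _ => measureReal_nonneg) ?_ hlim
  filter_upwards [eventually_ge_atTop 0] with T hT
  have hsub : {t : Fin d → 𝕋 | ‖t‖ < R} ⊆ box 𝕋 d R := fun t ht i => by
    have := (norm_le_pi_norm t i).trans_lt ht
    rw [hr.norm_eq] at this
    exact ⟨(abs_lt.1 this).1, (abs_lt.1 this).2.le⟩
  rw [boxMeasure, measureReal_ennreal_smul_apply, ENNReal.toReal_ofReal (by positivity)]
  gcongr
  refine ENNReal.toReal_mono (hr.finite_box R).ne ?_
  exact (Measure.restrict_apply_le _ _).trans (measure_mono hsub)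

end Boxes

/-! ### Ergodicity and weak mixing -/

section Equivalence

variable {𝕋 : Type} [NormedAddCommGroup 𝕋] [MeasurableSpace 𝕋] [Axis 𝕋] {d : ℕ}
variable [OpensMeasurableSpace (Fin d → 𝕋)] [MeasurableSub 𝕋]
variable {Ω : Type*} [MeasurableSpace Ω] {P : Measure Ω} [IsProbabilityMeasure P]
  {X : (Fin d → 𝕋) → Ω → ℝ}

theorem IsErgodic.isWeaklyMixing (hr : IsRegularAxis 𝕋 d) {α : ℝ} (hα : 0 < α)
    (hX : IsMeasurableField X) (hs : IsStationary P X) (hstable : IsSaSField α P X)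
    (he : IsErgodic P X) : IsWeaklyMixing P X := by
  have := hr.isFiniteMeasure
  have hν := hr.tendsto_real_univ
  set μ := P.map fun ω s => X s ω with hμ
  have : IsProbabilityMeasure μ := Measure.isProbabilityMeasure_map hX.measurable_path.aemeasurable
  have hS := measurePreserving_shift hX hs
  have : SecondCountableTopology (Lp ℂ 2 μ) := secondCountable_Lp_law P hX
  have hmean := meanZero_of_indicator μ hS hν
    (fun A B hA hB => by
      simp only [hμ, real_inter_translate hX _ hA hB]
      exact measurable_real_inter_translate hX hA hB)
    (fun A B hA hB => by
      simp only [hμ, real_inter_translate hX _ hA hB, real_pathEvent hX hA, real_pathEvent hX hB]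
      exact (he A B hA hB).congr' (average_eventuallyEq _))
  have habs := absMeanZero_of_isSaSLaw μ hα
    (fun W hW => isSaSLaw_of_mem_coordSpan hX hstable hW) hS
    (fun t W hW => comp_shift_mem_coordSpan t hW) hν hmean
  -- The correlations of all pairs from a dense sequence are enumerated through `Nat.unpair`, so
  -- that one function `u` and one set `D` serve them all.
  let e := TopologicalSpace.denseSeq (Lp ℂ 2 μ)
  obtain ⟨u, hu, hu0, hu1, hlim, hctrl⟩ := exists_common_majorant hν
    (fun j : ℕ => habs (e j.unpair.1) (e j.unpair.2))
  obtain ⟨D, hD, hD0, hDu⟩ := exists_full_density_set hu hu0 hu1 hlim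
    (size := fun t : Fin d → 𝕋 => ‖t‖) continuous_norm.measurable
    ((eventually_ge_atTop 0).mono fun T hT => hr.ae_norm_le hT)
  refine ⟨D, (hasDensityOne_iff hD).2 hD0, fun A B hA hB τ hτ hinf => ?_⟩
  have hj := hctrl τ (hDu τ hτ hinf)
  -- Vanishing along `τ` is closed under uniform limits, so it passes from the dense sequence to
  -- arbitrary indicators; hence `D` does not depend on `A` and `B`.
  have hvan := (uniformlyClosed_vanishingAlong τ).inner_mem
    (TopologicalSpace.denseRange_denseSeq (Lp ℂ 2 μ)).isTotal
    (fun t => centredKoopman μ (hS t)) (fun t => norm_centredKoopman_le μ (hS t)) (by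
      rintro _ ⟨i, rfl⟩ _ ⟨j, rfl⟩
      have := hj (Nat.pair i j)
      simp only [Nat.unpair_pair] at this
      exact this)
    ((memLp_indicator_one μ hA).toLp _) ((memLp_indicator_one μ hB).toLp _)
  have h0 : Tendsto (fun n => ((μ.real (A ∩ shift (τ n) ⁻¹' B) - μ.real A * μ.real B : ℝ) : ℂ))
      atTop (𝓝 0) :=
    Tendsto.congr (fun n => inner_centredKoopman_indicator μ (hS (τ n)) hA hB) hvan
  have h1 := (Complex.continuous_re.tendsto _).comp h0
  simp only [Function.comp_def, Complex.ofReal_re, Complex.zero_re, hμ,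
    real_inter_translate hX _ hA hB, real_pathEvent hX hA, real_pathEvent hX hB] at h1
  exact tendsto_sub_nhds_zero_iff.1 h1


theorem IsWeaklyMixing.isErgodic (hr : IsRegularAxis 𝕋 d) (hd : 1 ≤ d)
    (hX : IsMeasurableField X) (hw : IsWeaklyMixing P X) : IsErgodic P X := by
  have := hr.isFiniteMeasure
  have hν := hr.tendsto_real_univ
  obtain ⟨D, hD1, hD⟩ := hw
  have hDm : MeasurableSet D := hD1.1.of_compl
  intro A B hA hB
  set c := P.real (pathEvent X A) * P.real (pathEvent X B)
  set h : (Fin d → 𝕋) → ℝ := fun t => P.real (pathEvent X A ∩ translate X t B)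
  have hm : Measurable h := measurable_real_inter_translate hX hA hB
  have hbd : ∀ t, |h t - c| ≤ 1 := fun t => by
    have h0 : 0 ≤ h t := measureReal_nonneg
    have h1 : h t ≤ 1 := measureReal_le_one
    have h2 : 0 ≤ c := mul_nonneg measureReal_nonneg measureReal_nonneg
    have h3 : c ≤ 1 := mul_le_one₀ measureReal_le_one measureReal_nonneg measureReal_le_one
    exact abs_le.2 ⟨by linarith, by linarith⟩
  have hfar : ∀ ε > 0, ∃ R : ℝ, ∀ t ∈ D, R ≤ ‖t‖ → |h t - c| < ε := by
    intro ε hε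
    -- Otherwise points of `D` with norm at least `n` and deviation at least `ε` form a sequence
    -- that contradicts weak mixing.
    by_contra! hcon
    choose τ hτ hτR hτε using fun n : ℕ => hcon n
    have := hD A B hA hB τ hτ (tendsto_atTop_mono hτR tendsto_natCast_atTop_atTop)
    obtain ⟨n, hn⟩ := (Metric.tendsto_nhds.1 this ε hε).exists
    exact absurd hn (not_lt.2 (hτε n))
  have hi : ∀ T, Integrable (fun t => h t - c) (boxMeasure 𝕋 d T) := fun T =>
    Integrable.of_bound (hm.sub_const c).aestronglyMeasurable 1 (Eventually.of_forall hbd)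
  have hzero : Tendsto (fun T => ∫ t, |h t - c| ∂boxMeasure 𝕋 d T) atTop (𝓝 0) := by
    refine tendsto_zero_of_approx (fun _ => integral_nonneg fun _ => abs_nonneg _) hν
      fun ε hε => ?_
    obtain ⟨R, hR⟩ := hfar ε hε
    have hball : MeasurableSet {t : Fin d → 𝕋 | ‖t‖ < R} :=
      measurableSet_lt continuous_norm.measurable measurable_const
    -- Pointwise, `|h - c|` is at most 1 on `Dᶜ` and on the ball, and less than `ε` elsewhere.
    refine ⟨fun T => (boxMeasure 𝕋 d T).real Dᶜ + (boxMeasure 𝕋 d T).real {t | ‖t‖ < R}, ?_,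
      fun T => ?_⟩
    · simpa using ((hasDensityOne_iff hDm).1 hD1).add (hr.tendsto_real_ball hd R)
    · have i1 : Integrable (Dᶜ.indicator (1 : (Fin d → 𝕋) → ℝ)) (boxMeasure 𝕋 d T) :=
        (integrable_const 1).indicator hDm.compl
      have i2 : Integrable ({t : Fin d → 𝕋 | ‖t‖ < R}.indicator (1 : (Fin d → 𝕋) → ℝ))
          (boxMeasure 𝕋 d T) := (integrable_const 1).indicator hball
      have i12 : Integrable (fun t => Dᶜ.indicator (1 : (Fin d → 𝕋) → ℝ) t +
          {t : Fin d → 𝕋 | ‖t‖ < R}.indicator (1 : (Fin d → 𝕋) → ℝ) t) (boxMeasure 𝕋 d T) :=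
        i1.add i2
      have h3 : (boxMeasure 𝕋 d T).real Dᶜ + (boxMeasure 𝕋 d T).real {t | ‖t‖ < R} +
          ε * (boxMeasure 𝕋 d T).real Set.univ =
          ∫ t, (Dᶜ.indicator (1 : (Fin d → 𝕋) → ℝ) t +
            {t : Fin d → 𝕋 | ‖t‖ < R}.indicator (1 : (Fin d → 𝕋) → ℝ) t + ε)
              ∂boxMeasure 𝕋 d T := by
        rw [integral_add i12 (integrable_const _), integral_add i1 i2,
          integral_indicator_one hDm.compl, integral_indicator_one hball, integral_const,
          smul_eq_mul, mul_comm ε]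
      rw [h3]
      refine integral_mono_of_nonneg (Eventually.of_forall fun _ => abs_nonneg _)
        (i12.add (integrable_const _)) (Eventually.of_forall fun t => ?_)
      have n1 : 0 ≤ Dᶜ.indicator (1 : (Fin d → 𝕋) → ℝ) t :=
        Set.indicator_nonneg (fun _ _ => zero_le_one) t
      have n2 : 0 ≤ {t : Fin d → 𝕋 | ‖t‖ < R}.indicator (1 : (Fin d → 𝕋) → ℝ) t :=
        Set.indicator_nonneg (fun _ _ => zero_le_one) t
      have b := hbd t
      by_cases ht : t ∈ D
      · by_cases hRt : ‖t‖ < R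
        · have e2 : {t : Fin d → 𝕋 | ‖t‖ < R}.indicator (1 : (Fin d → 𝕋) → ℝ) t = 1 :=
            Set.indicator_of_mem (show t ∈ {t : Fin d → 𝕋 | ‖t‖ < R} from hRt) _
          simp only [e2]
          linarith
        · have := hR t ht (not_lt.1 hRt)
          simp only
          linarith
      · have e1 : Dᶜ.indicator (1 : (Fin d → 𝕋) → ℝ) t = 1 := Set.indicator_of_mem ht _
        simp only [e1]
        linarith
  have hlim : Tendsto (fun T => ∫ t, (h t - c) ∂boxMeasure 𝕋 d T) atTop (𝓝 0) :=
    squeeze_zero_norm (fun T => norm_integral_le_integral_norm _) hzero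
  refine Tendsto.congr' (average_eventuallyEq h).symm ?_
  have := hlim.add (hν.mul_const c)
  rw [zero_add, one_mul] at this
  refine this.congr fun T => ?_
  have hi' : Integrable h (boxMeasure 𝕋 d T) :=
    Integrable.of_bound hm.aestronglyMeasurable 1 (Eventually.of_forall fun t => by
      rw [Real.norm_of_nonneg measureReal_nonneg]; exact measureReal_le_one)
  rw [integral_sub hi' (integrable_const _), integral_const, smul_eq_mul, sub_add_cancel]

theorem isErgodic_iff_isWeaklyMixing (hr : IsRegularAxis 𝕋 d) (hd : 1 ≤ d) {α : ℝ} (hα : 0 < α)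
    (hX : IsMeasurableField X) (hs : IsStationary P X) (hstable : IsSaSField α P X) :
    IsErgodic P X ↔ IsWeaklyMixing P X :=
  ⟨fun h => h.isWeaklyMixing hr hα hX hs hstable, fun h => h.isErgodic hr hd hX⟩

end Equivalence

/-! ### The two axes -/

section Axes

theorem isRegularAxis_real (d : ℕ) : IsRegularAxis ℝ d := by
  have hbox : ∀ T, box ℝ d T = Set.univ.pi fun _ => Set.Ioc (-T) T := fun T => by
    ext t
    simp [box, Axis.toReal]
  have hvol : ∀ T, (Axis.refMeasure d : Measure (Fin d → ℝ)) (box ℝ d T) =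
      ENNReal.ofReal (2 * T) ^ d := fun T => by
    rw [hbox]
    change volume _ = _
    rw [volume_pi_pi]
    simp [two_mul]
  refine ⟨measurable_id, fun x => rfl, fun T => ?_, ?_⟩
  · rw [hvol]
    exact ENNReal.pow_lt_top ENNReal.ofReal_lt_top
  · refine tendsto_const_nhds.congr' ?_
    filter_upwards [eventually_gt_atTop 0] with T hT
    rw [average, setIntegral_const, measureReal_def, hvol, ENNReal.toReal_pow,
      ENNReal.toReal_ofReal (by positivity), smul_eq_mul, mul_one, inv_mul_cancel₀ (by positivity)]

theorem isRegularAxis_int (d : ℕ) : IsRegularAxis ℤ d := by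
  have hbox : ∀ T, box ℤ d T = (Fintype.piFinset fun _ : Fin d => Finset.Ioc ⌊-T⌋ ⌊T⌋) :=
    fun T => by
      ext t
      simp [box, Axis.toReal, Int.floor_lt, Int.le_floor]
  have hcount : ∀ T, (Axis.refMeasure d : Measure (Fin d → ℤ)) (box ℤ d T) =
      (((⌊T⌋ - ⌊-T⌋).toNat ^ d : ℕ) : ENNReal) := fun T => by
    rw [hbox]
    change Measure.count _ = _
    rw [Measure.count_apply_finset]
    simp
  refine ⟨measurable_from_top, fun x => rfl, fun T => ?_, ?_⟩
  · rw [hcount]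
    exact ENNReal.natCast_lt_top _
  -- The half-open interval `(-T, T]` contains `⌊T⌋ - ⌊-T⌋ = ⌊T⌋ + ⌈T⌉` integers, which is `2T` only
  -- asymptotically.
  · have hlim : Tendsto (fun T : ℝ => ((⌊T⌋₊ / T + ⌈T⌉₊ / T) / 2) ^ d) atTop (𝓝 1) := by
      have := ((tendsto_nat_floor_div_atTop (R := ℝ)).add
        (tendsto_nat_ceil_div_atTop (R := ℝ))).div_const 2 |>.pow d
      norm_num at this
      exact this
    refine hlim.congr' ?_
    filter_upwards [eventually_gt_atTop 0] with T hT
    have hcard : (((⌊T⌋ - ⌊-T⌋).toNat : ℕ) : ℝ) = ⌊T⌋₊ + ⌈T⌉₊ := by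
      rw [Int.floor_neg, sub_neg_eq_add, ← Int.natCast_floor_eq_floor hT.le,
        ← Int.natCast_ceil_eq_ceil hT.le, ← Nat.cast_add, Int.toNat_natCast, Nat.cast_add]
    rw [average, setIntegral_const, measureReal_def, hcount, ENNReal.toReal_natCast, Nat.cast_pow,
      hcard, smul_eq_mul, mul_one, ← inv_pow, ← mul_pow]
    congr 1
    field_simp

end Axes

end StableField

theorem mainTheorem6 {Ω : Type*} [MeasurableSpace Ω] (P : Measure Ω) [IsProbabilityMeasure P]
    (α : ℝ) (hα₀ : 0 < α) (hα₂ : α < 2) (d : ℕ) (hd : 1 ≤ d) :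
    (∀ X : (Fin d → ℤ) → Ω → ℝ,
      StableField.IsMeasurableField X → StableField.IsStationary P X →
      StableField.IsSaSField α P X →
        (StableField.IsErgodic P X ↔ StableField.IsWeaklyMixing P X)) ∧
    (∀ X : (Fin d → ℝ) → Ω → ℝ,
      StableField.IsMeasurableField X → StableField.IsStationary P X →
      StableField.IsSaSField α P X →
        (StableField.IsErgodic P X ↔ StableField.IsWeaklyMixing P X)) :=
  ⟨fun _ hX hs hstable => StableField.isErgodic_iff_isWeaklyMixing
      (StableField.isRegularAxis_int d) hd hα₀ hX hs hstable,
    fun _ hX hs hstable => StableField.isErgodic_iff_isWeaklyMixing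
      (StableField.isRegularAxis_real d) hd hα₀ hX hs hstable⟩
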